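/- Let $d\ge 2$. For $x\in\mathbb{R}^d$ put $\|x\|^{(\mathrm{nid})}_\infty=\min_{k\in\mathbb{Z}^d}\|x+k\|_\infty$, and for a sequence $(x_n)_{n\ge1}$ in $[0,1)^d$ and $N\ge2$ let $$\delta^\infty_{\min}((x_n),N)=\min\{\|x_n-x_m\|^{(\mathrm{nid})}_\infty : 1\le m\ne n\le N\}.$$ Write $\{\cdot\}$ for the fractional part and $\log_2 N=\log\log N$. Almost all refers to Lebesgue measure. (1) Let $(a^{(1)}_n)_{n\ge1},\dots,(a^{(d)}_n)_{n\ge1}$ be strictly increasing sequences of natural numbers, $\boldsymbol{a}_n=(a^{(1)}_n,\dots,a^{(d)}_n)$, $\boldsymbol{A}_N=\{\boldsymbol{a}_n: n\le N\}$, and let $\boldsymbol{C}_N$ be the number of vectors in $\boldsymbol{A}_N-\boldsymbol{A}_N$ all of whose coordinates are positive. Then for every $\varepsilon>0$, for almost every $\boldsymbol{\alpha}=(\alpha_1,\dots,\alpha_d)\in[0,1]^d$, the sequence $\{\boldsymbol{a}_n\boldsymbol{\alpha}\}=(\{a^{(1)}_n\alpha_1\},\dots,\{a^{(d)}_n\alpha_d\})$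 satisfies $$\delta^\infty_{\min}((\{\boldsymbol{a}_n\boldsymbol{\alpha}\}),N)\ge\frac{1}{\boldsymbol{C}_N^{1/d}(\log N)^{1/d}(\log_2 N)^{1/d+\varepsilon}}\quad\text{for all sufficiently large }N.$$ (2) Let $(a_n)_{n\ge1}$ be a sequence of distinct integers, $A_N=\{a_1,\dots,a_N\}$, and let $C_N$ be the number of positive elements of $A_N-A_N$. Then for almost every $\boldsymbol{\alpha}\in[0,1]^d$, the sequence $\{a_n\boldsymbol{\alpha}\}=(\{a_n\alpha_1\},\dots,\{a_n\alpha_d\})$ satisfies $$\delta^\infty_{\min}((\{a_n\boldsymbol{\alpha}\}),N)\le\frac{1}{C_N^{1/d}(\log N)^{1/d}(\log_2 N)^{1/d}}\quad\text{for infinitely many }N.$$ -/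

import Mathlib

open MeasureTheory Filter
open scoped Pointwise

namespace MinimalGap

/-- The distance from `x ∈ ℝ^d` to the nearest integer vector in the `∞`-norm, `min_{k ∈ ℤ^d} ‖x + k‖_∞`
(the norm of `Fin d → ℝ` is the sup norm). -/
noncomputable def nid {d : ℕ} (x : Fin d → ℝ) : ℝ :=
  ⨅ k : Fin d → ℤ, ‖x + fun i => (k i : ℝ)‖

/-- The `∞`-norm minimal gap of the first `N` terms `x 0, …, x (N - 1)` of a sequence in `ℝ^d`:
the minimum of the nearest integer distances of `x n - x m` over distinct indices
(sequences are indexed from `0`; meaningful for `N ≥ 2`). -/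
noncomputable def minGap {d : ℕ} (x : ℕ → Fin d → ℝ) (N : ℕ) : ℝ :=
  sInf {r : ℝ | ∃ m n : ℕ, m < N ∧ n < N ∧ m ≠ n ∧ r = nid (x n - x m)}

/-- The sequence `({a_n α}) = ({a_n^{(1)} α_1}, …, {a_n^{(d)} α_d})` for a sequence of integer vectors. -/
noncomputable def fractSeq {d : ℕ} (a : ℕ → Fin d → ℤ) (α : Fin d → ℝ) : ℕ → Fin d → ℝ :=
  fun n i => Int.fract ((a n i : ℝ) * α i)

/-- The set `A_N` of the first `N` terms of a sequence. -/
def firstTerms {β : Type*} [DecidableEq β] (a : ℕ → β) (N : ℕ) : Finset β :=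
  (Finset.range N).image a

/-- `(A_N - A_N)^+` for a sequence of integer vectors: the differences all of whose coordinates
are positive. -/
def posDiffVec {d : ℕ} (a : ℕ → Fin d → ℤ) (N : ℕ) : Finset (Fin d → ℤ) :=
  (firstTerms a N - firstTerms a N).filter fun c => ∀ i, 0 < c i

/-- `(A_N - A_N)^+` for a sequence of integers: the positive differences. -/
def posDiff (a : ℕ → ℤ) (N : ℕ) : Finset ℤ :=
  (firstTerms a N - firstTerms a N).filter fun c => 0 < c

end MinimalGap

/-! On the torus the gap is the smallest `‖c • x‖` over differences `c` of the first `N` terms, so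
both statements are Borel–Cantelli results with `C_N` counting the events at stage `N`.

Lower bound: coordinatewise multiplication by nonzero integers preserves Haar measure, so `‖c • x‖ <
ρ` has probability at most `(2ρ)^d`. Grouping the `N` with `2^j ≤ C_N < 2^(j+1)` and using `C_N ≤
N^2`, hence `log N ≫ j`, bounds the total probability by a multiple of `∑ 1/(j (log j)^(1+dε))`,
which converges.

Upper bound: all coordinates are multiplied by the same `q`. Along lengths at which `C_N` at least
doubles, each difference is given the radius of the stage at which it first appears. The resulting
function `ψ` has divergent `∑ ψ(q)^d` but no monotonicity, so Gallagher's theorem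
(`Torus.ae_frequently_norm_nsmul_lt`) is needed. For it, neighbourhoods of the points of exact order
`q` are quasi-independent in `q`, and for `d ≥ 2` they have measure comparable to `ψ(q)^d` because a
positive proportion of the `q`-torsion has exact order `q`. Kochen–Stone gives positive measure, and
ergodicity of `x ↦ 2x` upgrades it to full measure. -/

namespace MinimalGap

/-- The `d`-dimensional torus `ℝ^d / ℤ^d`. -/
abbrev Torus (d : ℕ) : Type := Fin d → UnitAddCircle

/-! ### Volumes of balls and counting of torsion points on the torus. -/

namespace Torus

variable {d : ℕ}

lemma volume_closedBall_le (x : Torus d) {r : ℝ} (hr : 0 ≤ r) :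
    volume (Metric.closedBall x r) ≤ ENNReal.ofReal ((2 * r) ^ d) := by
  rw [MeasureTheory.volume_pi_closedBall x hr, ENNReal.ofReal_pow (by positivity)]
  simp only [AddCircle.volume_closedBall]
  calc _ ≤ ∏ _i : Fin d, ENNReal.ofReal (2 * r) :=
        Finset.prod_le_prod' fun i _ => ENNReal.ofReal_le_ofReal (min_le_right _ _)
    _ = _ := by simp

lemma volume_closedBall (x : Torus d) {r : ℝ} (hr : 0 ≤ r) (hr1 : 2 * r ≤ 1) :
    volume (Metric.closedBall x r) = ENNReal.ofReal ((2 * r) ^ d) := by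
  rw [MeasureTheory.volume_pi_closedBall x hr, ENNReal.ofReal_pow (by positivity)]
  simp [AddCircle.volume_closedBall, min_eq_right hr1]

/-- The map from `(ℤ/q)^d` onto the `q`-torsion points of the torus. -/
noncomputable def ofZMod (d q : ℕ) [NeZero q] (v : Fin d → ZMod q) : Torus d :=
  fun i => ZMod.toAddCircle (v i)

lemma ofZMod_injective (q : ℕ) [NeZero q] : Function.Injective (ofZMod d q) := by
  intro v w h
  ext i
  exact ZMod.toAddCircle_injective q (congrFun h i)

lemma range_ofZMod (q : ℕ) [NeZero q] :
    Set.range (ofZMod d q) = {y : Torus d | q • y = 0} := by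
  ext y
  constructor
  · rintro ⟨v, rfl⟩
    ext i
    simp only [Pi.smul_apply, ofZMod, Pi.zero_apply]
    rw [← map_nsmul]
    simp
  · intro h
    have h1 : ∀ i, ∃ v : ZMod q, ZMod.toAddCircle v = y i := by
      intro i
      obtain ⟨m, -, hm⟩ := (AddCircle.nsmul_eq_zero_iff (p := (1 : ℝ)) (u := y i)
        (Nat.pos_of_ne_zero (NeZero.ne q))).1 (congrFun h i)
      refine ⟨(m : ZMod q), ?_⟩
      rw [ZMod.toAddCircle_natCast, ← hm, mul_one]
    choose v hv using h1
    exact ⟨v, funext hv⟩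

lemma finite_torsion {q : ℕ} (hq : 0 < q) : {y : Torus d | q • y = 0}.Finite := by
  have : NeZero q := ⟨hq.ne'⟩
  rw [← range_ofZMod]
  exact Set.finite_range _

lemma ncard_torsion {q : ℕ} (hq : 0 < q) : {y : Torus d | q • y = 0}.ncard = q ^ d := by
  have : NeZero q := ⟨hq.ne'⟩
  rw [← range_ofZMod, ← Set.image_univ, Set.ncard_image_of_injective _ (ofZMod_injective q),
    Set.ncard_univ]
  simp

lemma inv_le_norm_of_torsion {q : ℕ} (hq : 0 < q) {y : Torus d} (hy : q • y = 0) (h0 : y ≠ 0) :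
    1 / (q : ℝ) ≤ ‖y‖ := by
  obtain ⟨i, hi⟩ : ∃ i, y i ≠ 0 := by
    by_contra! h
    exact h0 (funext h)
  have hyi : q • y i = 0 := congrFun hy i
  have hfin : IsOfFinAddOrder (y i) := isOfFinAddOrder_iff_nsmul_eq_zero.2 ⟨q, hq, hyi⟩
  have h1 := AddCircle.le_add_order_smul_norm_of_isOfFinAddOrder hfin hi
  have h2 : addOrderOf (y i) ≤ q := Nat.le_of_dvd hq (addOrderOf_dvd_of_nsmul_eq_zero hyi)
  have h3 : (1 : ℝ) ≤ q * ‖y i‖ := by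
    refine h1.trans ?_
    rw [nsmul_eq_mul]
    gcongr
  rw [div_le_iff₀ (by positivity), mul_comm]
  exact h3.trans (by gcongr; exact norm_le_pi_norm y i)

lemma eq_of_torsion_of_dist_lt {q : ℕ} (hq : 0 < q) {y z : Torus d} (hy : q • y = 0)
    (hz : q • z = 0) (h : dist y z < 1 / (q : ℝ)) : y = z := by
  by_contra hne
  have := inv_le_norm_of_torsion hq (y := y - z) (by rw [smul_sub, hy, hz, sub_zero])
    (sub_ne_zero.2 hne)
  rw [dist_eq_norm] at h
  linarith

/-- Packing bound for a finite set of `q`-torsion points inside a ball. -/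
lemma card_torsion_ball_le {q : ℕ} (hq : 0 < q) (s : Finset (Torus d)) {R : ℝ} (hR : 0 ≤ R)
    (hs : ∀ y ∈ s, q • y = 0 ∧ ‖y‖ ≤ R) : (s.card : ℝ) ≤ (4 * R * q + 1) ^ d := by
  have hq' : (0 : ℝ) < q := by exact_mod_cast hq
  have hq1 : (1 : ℝ) ≤ q := by exact_mod_cast hq
  -- Distinct `q`-torsion points are at least `1/q` apart, so balls of radius `1/(4q)` are disjoint;
  -- the volume ratio `((R + r)/r)^d` is the claimed bound.
  set r : ℝ := 1 / (4 * q) with hr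
  have hr0 : 0 < r := by positivity
  have hrq : r * (4 * q) = 1 := by rw [hr]; field_simp
  have hdisj : (s : Set (Torus d)).PairwiseDisjoint fun y => Metric.closedBall y r := by
    intro y hy z hz hne
    refine Metric.closedBall_disjoint_closedBall ?_
    by_contra! hlt
    refine hne (eq_of_torsion_of_dist_lt hq (hs y hy).1 (hs z hz).1 (hlt.trans_lt ?_))
    rw [lt_div_iff₀ hq']
    nlinarith
  have h1 : ∑ y ∈ s, volume (Metric.closedBall y r) ≤
      volume (Metric.closedBall (0 : Torus d) (R + r)) := by
    rw [← measure_biUnion_finset hdisj fun _ _ => Metric.isClosed_closedBall.measurableSet]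
    refine measure_mono (Set.iUnion₂_subset fun y hy => ?_)
    refine Metric.closedBall_subset_closedBall' ?_
    rw [dist_zero_right]
    linarith [(hs y hy).2]
  have h2 := h1.trans (volume_closedBall_le 0 (by positivity))
  rw [Finset.sum_congr rfl fun y _ => volume_closedBall y hr0.le (by nlinarith)] at h2
  rw [Finset.sum_const, nsmul_eq_mul, ← ENNReal.ofReal_natCast,
    ← ENNReal.ofReal_mul (by positivity), ENNReal.ofReal_le_ofReal_iff (by positivity)] at h2
  have h3 : (s.card : ℝ) * (2 * r) ^ d ≤ (4 * R * q + 1) ^ d * (2 * r) ^ d := by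
    refine h2.trans (le_of_eq ?_)
    rw [← mul_pow]
    congr 1
    linear_combination (-2 * R) * hrq
  exact le_of_mul_le_mul_right h3 (by positivity)

/-- Two pairs with the same difference are translates of each other by a point that is both `q`- and
`r`-torsion, hence `gcd`-torsion, and there are `gcd^d` of these. -/
lemma card_sub_fiber_le {q r : ℕ} (hq : 0 < q) (s : Finset (Torus d × Torus d))
    (hs : ∀ p ∈ s, q • p.1 = 0 ∧ r • p.2 = 0) (w : Torus d) (hw : ∀ p ∈ s, p.1 - p.2 = w) :
    s.card ≤ q.gcd r ^ d := by
  rcases s.eq_empty_or_nonempty with rfl | ⟨p₀, hp₀⟩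
  · simp
  have hg : 0 < q.gcd r := Nat.gcd_pos_of_pos_left _ hq
  rw [← ncard_torsion hg, ← Set.ncard_coe_finset]
  refine Set.ncard_le_ncard_of_injOn (fun p => p.1 - p₀.1) ?_ ?_ (finite_torsion hg)
  · intro p hp
    have h1 : q • (p.1 - p₀.1) = 0 := by rw [smul_sub, (hs p hp).1, (hs p₀ hp₀).1, sub_zero]
    have h2 : p.1 - p₀.1 = p.2 - p₀.2 := by
      rw [sub_eq_sub_iff_sub_eq_sub, hw p hp, hw p₀ hp₀]
    have h3 : r • (p.1 - p₀.1) = 0 := by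
      rw [h2, smul_sub, (hs p hp).2, (hs p₀ hp₀).2, sub_zero]
    exact addOrderOf_dvd_iff_nsmul_eq_zero.1
      (Nat.dvd_gcd (addOrderOf_dvd_of_nsmul_eq_zero h1) (addOrderOf_dvd_of_nsmul_eq_zero h3))
  · intro p hp p' hp' h
    have h1 : p.1 = p'.1 := sub_left_injective h
    refine Prod.ext h1 ?_
    have := (hw p hp).trans (hw p' hp').symm
    rw [h1] at this
    exact sub_right_injective this

/-- The number of pairs consisting of a `q`-torsion point and an `r`-torsion point at distance at
most `R`. -/
lemma card_close_pairs_le {q r : ℕ} (hq : 0 < q) (hr : 0 < r) (s : Finset (Torus d × Torus d))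
    {R : ℝ} (hR : 1 ≤ q.lcm r * R)
    (hs : ∀ p ∈ s, q • p.1 = 0 ∧ r • p.2 = 0 ∧ dist p.1 p.2 ≤ R) :
    (s.card : ℝ) ≤ (5 * R * q * r) ^ d := by
  classical
  have hL : 0 < q.lcm r := Nat.lcm_pos hq hr
  have hL' : (0 : ℝ) < q.lcm r := by exact_mod_cast hL
  have hR0 : 0 ≤ R := by
    by_contra! h
    nlinarith
  set t : Finset (Torus d) := s.image fun p => p.1 - p.2
  -- The differences are `lcm`-torsion points of norm at most `R`, so packing bounds their number.
  -- Together with the fibre bound, `gcd * lcm = q * r` gives the product; `hR` absorbs the `+ 1` of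
  -- the packing bound and turns 4 into 5.
  have h1 : s.card ≤ q.gcd r ^ d * t.card := by
    refine Finset.card_le_mul_card_image s _ fun w _ => ?_
    refine card_sub_fiber_le hq _ (fun p hp => ?_) w fun p hp => (Finset.mem_filter.1 hp).2
    exact ⟨(hs p (Finset.mem_filter.1 hp).1).1, (hs p (Finset.mem_filter.1 hp).1).2.1⟩
  have h2 : (t.card : ℝ) ≤ (4 * R * (q.lcm r : ℕ) + 1) ^ d := by
    refine card_torsion_ball_le hL t hR0 fun y hy => ?_
    obtain ⟨p, hp, rfl⟩ := Finset.mem_image.1 hy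
    obtain ⟨h1, h2, h3⟩ := hs p hp
    refine ⟨?_, by rwa [← dist_eq_norm]⟩
    rw [smul_sub, addOrderOf_dvd_iff_nsmul_eq_zero.1
        ((addOrderOf_dvd_of_nsmul_eq_zero h1).trans (Nat.dvd_lcm_left q r)),
      addOrderOf_dvd_iff_nsmul_eq_zero.1
        ((addOrderOf_dvd_of_nsmul_eq_zero h2).trans (Nat.dvd_lcm_right q r)), sub_zero]
  have hgl : ((q.gcd r : ℕ) : ℝ) * (q.lcm r : ℕ) = q * r := by exact_mod_cast Nat.gcd_mul_lcm q r
  calc (s.card : ℝ) ≤ (q.gcd r : ℝ) ^ d * t.card := by exact_mod_cast h1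
    _ ≤ (q.gcd r : ℝ) ^ d * (4 * R * (q.lcm r : ℕ) + 1) ^ d := by gcongr
    _ ≤ (q.gcd r : ℝ) ^ d * (5 * R * (q.lcm r : ℕ)) ^ d := by
        gcongr
        nlinarith
    _ = _ := by
        rw [← mul_pow]
        congr 1
        linear_combination (5 * R) * hgl

/-- Telescoping comparison starting from the exact term `1/4`. What matters is a bound below 1: it
leaves a quarter of the torsion points with exact order. -/
lemma sum_inv_sq_le (n : ℕ) : ∑ l ∈ Finset.Icc 2 n, 1 / (l : ℝ) ^ 2 ≤ 3 / 4 := by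
  have key : ∀ n : ℕ, ∑ l ∈ Finset.Icc 2 (n + 2), 1 / (l : ℝ) ^ 2 ≤ 3 / 4 - 1 / ((n : ℝ) + 2) := by
    intro n
    induction n with
    | zero => norm_num
    | succ n ih =>
      rw [show n + 1 + 2 = (n + 2) + 1 by ring, Finset.sum_Icc_succ_top (by omega)]
      have : 1 / (((n + 2 + 1 : ℕ) : ℝ)) ^ 2 ≤ 1 / ((n : ℝ) + 2) - 1 / (n + 3) := by
        rw [div_sub_div _ _ (by positivity) (by positivity), div_le_div_iff₀ (by positivity)
          (by positivity)]
        push_cast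
        nlinarith [(Nat.cast_nonneg n : (0 : ℝ) ≤ n)]
      push_cast at this ⊢
      have e : ((n : ℝ) + 1 + 2) = n + 3 := by ring
      rw [e]
      linarith
  rcases Nat.lt_or_ge n 2 with h | h
  · rw [Finset.Icc_eq_empty (by omega)]; norm_num
  · obtain ⟨m, rfl⟩ := Nat.exists_eq_add_of_le h
    rw [add_comm 2 m]
    have : (0 : ℝ) ≤ 1 / ((m : ℝ) + 2) := by positivity
    linarith [key m]

lemma finite_addOrderOf_eq {q : ℕ} (hq : 0 < q) : {y : Torus d | addOrderOf y = q}.Finite :=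
  (finite_torsion hq).subset fun y hy => by
    have hy : addOrderOf y = q := hy
    exact addOrderOf_dvd_iff_nsmul_eq_zero.1 hy.dvd

/-- In dimension at least two a positive proportion of the `q`-torsion points have exact order
`q`. -/
lemma le_ncard_addOrderOf_eq (hd : 2 ≤ d) {q : ℕ} (hq : 0 < q) :
    (q : ℝ) ^ d / 4 ≤ ({y : Torus d | addOrderOf y = q}.ncard : ℝ) := by
  classical
  have hq' : (0 : ℝ) < q := by exact_mod_cast hq
  -- `T l` is the `q / l`-torsion. A torsion point of order less than `q` lies in `T l` for some
  -- divisor `l ≥ 2`; the union bound runs over all `l` from 2 to `q`, with rounded division, since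
  -- overcounting is harmless.
  set T : ℕ → Finset (Torus d) := fun l =>
    if h : 0 < q / l then (finite_torsion (d := d) h).toFinset else ∅ with hT
  have hTcard : ∀ l, (((T l).card : ℕ) : ℝ) ≤ (q : ℝ) ^ d / (l : ℝ) ^ d := by
    intro l
    simp only [hT]
    split_ifs with h
    · rw [← Set.ncard_eq_toFinset_card _ (finite_torsion h), ncard_torsion h, ← div_pow]
      push_cast
      gcongr
      exact Nat.cast_div_le
    · simp only [Finset.card_empty, Nat.cast_zero]
      positivity
  set P := (finite_addOrderOf_eq (d := d) hq).toFinset with hP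
  set E := (finite_torsion (d := d) hq).toFinset with hE
  have hsub : E ⊆ P ∪ (Finset.Icc 2 q).biUnion T := by
    intro y hy
    have hy' : q • y = 0 := by simpa [hE] using hy
    obtain ⟨l, hl⟩ := addOrderOf_dvd_of_nsmul_eq_zero hy'
    have hl0 : l ≠ 0 := by rintro rfl; omega
    have ho : 0 < addOrderOf y := Nat.pos_of_ne_zero fun h => by rw [h] at hl; omega
    rw [Finset.mem_union]
    by_cases hl1 : l = 1
    · left
      simp [hP, hl, hl1]
    · right
      rw [Finset.mem_biUnion]
      have hdiv : q / l = addOrderOf y := by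
        conv_lhs => rw [hl]
        exact Nat.mul_div_cancel _ (Nat.pos_of_ne_zero hl0)
      refine ⟨l, Finset.mem_Icc.2 ⟨by omega, ?_⟩, ?_⟩
      · rw [hl]; exact Nat.le_mul_of_pos_left _ ho
      · simp only [hT]
        rw [dif_pos (hdiv ▸ ho)]
        simp [hdiv, addOrderOf_nsmul_eq_zero]
  have h1 : (E.card : ℝ) ≤ P.card + ∑ l ∈ Finset.Icc 2 q, ((T l).card : ℝ) := by
    have := (Finset.card_le_card hsub).trans
      ((Finset.card_union_le _ _).trans (Nat.add_le_add_left Finset.card_biUnion_le _))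
    exact_mod_cast this
  have h2 : (E.card : ℝ) = (q : ℝ) ^ d := by
    rw [hE, ← Set.ncard_eq_toFinset_card _ (finite_torsion hq), ncard_torsion hq, Nat.cast_pow]
  have h3 : ∑ l ∈ Finset.Icc 2 q, ((T l).card : ℝ) ≤ (q : ℝ) ^ d * (3 / 4) := by
    calc _ ≤ ∑ l ∈ Finset.Icc 2 q, (q : ℝ) ^ d * (1 / (l : ℝ) ^ 2) := by
          refine Finset.sum_le_sum fun l hl => (hTcard l).trans ?_
          have hl2 : 2 ≤ l := (Finset.mem_Icc.1 hl).1
          have hl1 : (1 : ℝ) ≤ l := by exact_mod_cast (by omega : 1 ≤ l)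
          -- Here `d ≥ 2` enters: `l^(-d) ≤ l^(-2)`.
          rw [div_eq_mul_one_div]
          gcongr
      _ ≤ _ := by
          rw [← Finset.mul_sum]
          gcongr
          exact sum_inv_sq_le q
  rw [Set.ncard_eq_toFinset_card _ (finite_addOrderOf_eq hq)]
  change _ ≤ (P.card : ℝ)
  linarith

end Torus

/-! ### A second-moment Borel–Cantelli lemma. -/

section KochenStone

variable {Ω : Type*} [MeasurableSpace Ω] {μ : Measure Ω} [IsProbabilityMeasure μ]

/-- Let `X` count the events that occur. Pointwise `2tX - t²X²` is at most the indicator of the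
union, since `(1 - tX)² ≥ 0`. Integrating with `E X² ≤ S + K S²` and the optimal `t = 1/(1 + K S)`
gives the bound. -/
lemma le_measureReal_biUnion_of_quasi_indep {A : ℕ → Set Ω} (hA : ∀ n, MeasurableSet (A n))
    {K : ℝ} (hK : 0 ≤ K)
    (hind : ∀ m n, m ≠ n → μ.real (A m ∩ A n) ≤ K * (μ.real (A m) * μ.real (A n)))
    (s : Finset ℕ) :
    (∑ n ∈ s, μ.real (A n)) / (1 + K * ∑ n ∈ s, μ.real (A n)) ≤ μ.real (⋃ n ∈ s, A n) := by
  classical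
  set S := ∑ n ∈ s, μ.real (A n) with hS
  have hS0 : 0 ≤ S := Finset.sum_nonneg fun _ _ => measureReal_nonneg
  set f : ℕ → Ω → ℝ := fun n => (A n).indicator 1 with hf
  have hint : ∀ B : Set Ω, MeasurableSet B → Integrable (B.indicator (1 : Ω → ℝ)) μ := fun B hB =>
    (integrable_const (1 : ℝ)).indicator hB
  set t : ℝ := 1 / (1 + K * S) with ht
  have hden : 0 < 1 + K * S := by positivity
  have htt : t * (1 + K * S) = 1 := by rw [ht]; field_simp
  have ht0 : 0 < t := by positivity
  have hU : MeasurableSet (⋃ n ∈ s, A n) := s.measurableSet_biUnion fun n _ => hA n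
  have hprod : ∀ m n ω, f m ω * f n ω = (A m ∩ A n).indicator (1 : Ω → ℝ) ω := by
    intro m n ω
    simp [hf, Set.inter_indicator_one]
  have hpt : ∀ ω, 2 * t * ∑ n ∈ s, f n ω - t ^ 2 * ∑ m ∈ s, ∑ n ∈ s,
      (A m ∩ A n).indicator (1 : Ω → ℝ) ω ≤ (⋃ n ∈ s, A n).indicator (1 : Ω → ℝ) ω := by
    intro ω
    have : ∑ m ∈ s, ∑ n ∈ s, (A m ∩ A n).indicator (1 : Ω → ℝ) ω = (∑ n ∈ s, f n ω) ^ 2 := by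
      rw [sq, Finset.sum_mul_sum]
      simp_rw [hprod]
    rw [this]
    by_cases hω : ω ∈ ⋃ n ∈ s, A n
    · rw [Set.indicator_of_mem hω]
      simp only [Pi.one_apply]
      nlinarith [sq_nonneg (1 - t * ∑ n ∈ s, f n ω)]
    · rw [Set.indicator_of_notMem hω]
      have : ∑ n ∈ s, f n ω = 0 := by
        refine Finset.sum_eq_zero fun n hn => Set.indicator_of_notMem (fun h => hω ?_) _
        exact Set.mem_biUnion hn h
      rw [this]; simp
  have hi1 : Integrable (fun ω => ∑ n ∈ s, f n ω) μ :=
    integrable_finsetSum _ fun n _ => hint _ (hA n)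
  have hi2 : Integrable (fun ω => ∑ m ∈ s, ∑ n ∈ s, (A m ∩ A n).indicator (1 : Ω → ℝ) ω) μ :=
    integrable_finsetSum _ fun m _ => integrable_finsetSum _ fun n _ =>
      hint _ ((hA m).inter (hA n))
  have h1 : ∫ ω, (2 * t * ∑ n ∈ s, f n ω - t ^ 2 * ∑ m ∈ s, ∑ n ∈ s,
      (A m ∩ A n).indicator (1 : Ω → ℝ) ω) ∂μ ≤ ∫ ω, (⋃ n ∈ s, A n).indicator 1 ω ∂μ :=
    integral_mono ((hi1.const_mul (2 * t)).sub (hi2.const_mul (t ^ 2))) (hint _ hU) hpt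
  rw [integral_sub (hi1.const_mul (2 * t)) (hi2.const_mul (t ^ 2)), integral_const_mul,
    integral_const_mul, integral_finsetSum _ fun n _ => hint _ (hA n),
    integral_finsetSum _ fun m _ => integrable_finsetSum _ fun n _ =>
      hint _ ((hA m).inter (hA n)), integral_indicator_one hU] at h1
  have h2 : ∀ m ∈ s, ∫ ω, ∑ n ∈ s, (A m ∩ A n).indicator (1 : Ω → ℝ) ω ∂μ =
      ∑ n ∈ s, μ.real (A m ∩ A n) := by
    intro m _
    rw [integral_finsetSum _ fun n _ => hint _ ((hA m).inter (hA n))]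
    exact Finset.sum_congr rfl fun n _ => integral_indicator_one ((hA m).inter (hA n))
  rw [Finset.sum_congr rfl h2,
    Finset.sum_congr rfl fun n _ => integral_indicator_one (hA n)] at h1
  have h3 : ∑ m ∈ s, ∑ n ∈ s, μ.real (A m ∩ A n) ≤ S + K * S ^ 2 := by
    calc _ ≤ ∑ m ∈ s, (μ.real (A m) + ∑ n ∈ s, K * (μ.real (A m) * μ.real (A n))) := by
          refine Finset.sum_le_sum fun m hm => ?_
          rw [← Finset.add_sum_erase _ _ hm, Set.inter_self]
          gcongr
          calc _ ≤ ∑ n ∈ s.erase m, K * (μ.real (A m) * μ.real (A n)) :=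
                Finset.sum_le_sum fun n hn => hind m n (Finset.ne_of_mem_erase hn).symm
            _ ≤ _ := Finset.sum_le_sum_of_subset_of_nonneg (Finset.erase_subset _ _)
                fun _ _ _ => by positivity
      _ = _ := by
          rw [Finset.sum_add_distrib, sq, hS, Finset.sum_mul_sum, Finset.mul_sum]
          simp_rw [Finset.mul_sum]
  have h4 : S / (1 + K * S) = 2 * t * S - t ^ 2 * (S + K * S ^ 2) := by
    rw [div_eq_mul_one_div, ← ht]
    linear_combination (t * S) * htt
  rw [h4]
  refine le_trans ?_ h1
  gcongr

/-- The Kochen–Stone form of the second Borel–Cantelli lemma. -/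
lemma le_measureReal_frequently_of_quasi_indep {A : ℕ → Set Ω} (hA : ∀ n, MeasurableSet (A n))
    {K : ℝ} (hK : 0 ≤ K)
    (hind : ∀ m n, m ≠ n → μ.real (A m ∩ A n) ≤ K * (μ.real (A m) * μ.real (A n)))
    (hsum : ¬ Summable fun n => μ.real (A n)) :
    1 / (1 + K) ≤ μ.real {ω | ∃ᶠ n in atTop, ω ∈ A n} := by
  have hset : {ω | ∃ᶠ n in atTop, ω ∈ A n} = ⋂ M : ℕ, ⋃ n ≥ M, A n := by
    ext ω
    simp [frequently_atTop]
  have hanti : Antitone fun M : ℕ => ⋃ n ≥ M, A n := by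
    intro M M' h
    exact Set.biUnion_mono (fun n (hn : M' ≤ n) => h.trans hn) fun _ _ => le_rfl
  have hmeas : ∀ M : ℕ, MeasurableSet (⋃ n ≥ M, A n) := fun M =>
    MeasurableSet.iUnion fun n => MeasurableSet.iUnion fun _ => hA n
  have hM : ∀ M : ℕ, 1 / (1 + K) ≤ μ.real (⋃ n ≥ M, A n) := by
    intro M
    rw [not_summable_iff_tendsto_nat_atTop_of_nonneg fun n => measureReal_nonneg] at hsum
    -- Divergence supplies a block `[M, N)` of total mass `S ≥ 1`, and `S/(1 + K S)` increases in
    -- `S`.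
    obtain ⟨N, hN, hMN⟩ := ((hsum.eventually_ge_atTop
      (1 + ∑ n ∈ Finset.range M, μ.real (A n))).and (eventually_ge_atTop M)).exists
    have hS : 1 ≤ ∑ n ∈ Finset.Ico M N, μ.real (A n) := by
      rw [Finset.sum_Ico_eq_sub _ hMN]
      linarith
    have h1 := le_measureReal_biUnion_of_quasi_indep hA hK hind (Finset.Ico M N)
    refine le_trans ?_ (h1.trans (measureReal_mono ?_ (measure_ne_top _ _)))
    · rw [div_le_div_iff₀ (by positivity) (by positivity)]
      nlinarith
    · exact Set.biUnion_mono (fun n hn => (Finset.mem_Ico.1 hn).1) fun _ _ => le_rfl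
  rw [hset, measureReal_def, hanti.measure_iInter (fun M => (hmeas M).nullMeasurableSet)
    ⟨0, measure_ne_top _ _⟩]
  rw [← ENNReal.ofReal_le_iff_le_toReal
    (ne_top_of_le_ne_top (measure_ne_top μ (⋃ n ≥ 0, A n)) (iInf_le _ 0))]
  refine le_iInf fun M => ?_
  exact (ENNReal.ofReal_le_iff_le_toReal (measure_ne_top _ _)).2 (hM M)

end KochenStone

/-! ### Gallagher's theorem for simultaneous approximation. -/

namespace Torus

variable {d : ℕ}

instance : IsProbabilityMeasure (volume : Measure (Torus d)) :=
  ⟨by rw [volume_pi, Measure.pi_univ]; simp⟩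

/-- Balls of radius `ρ/2` about the points of exact order `q` are disjoint, each has volume `ρ^d`,
and there are at least `q^d/4` of them. -/
lemma le_volume_approxAddOrderOf (hd : 2 ≤ d) {q : ℕ} (hq : 0 < q) {ρ : ℝ} (hρ : 0 ≤ ρ)
    (hρq : ρ * q ≤ 1 / 2) :
    (q * ρ) ^ d / 4 ≤ volume.real (approxAddOrderOf (Torus d) q ρ) := by
  have hq' : (0 : ℝ) < q := by exact_mod_cast hq
  have hq1 : (1 : ℝ) ≤ q := by exact_mod_cast hq
  rcases hρ.eq_or_lt with rfl | hρ
  · rw [mul_zero, zero_pow (by omega), zero_div]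
    exact measureReal_nonneg
  set P := (finite_addOrderOf_eq (d := d) hq).toFinset with hP
  have hPq : ∀ y ∈ P, addOrderOf y = q := fun y hy => by simpa [hP] using hy
  have hsub : (⋃ y ∈ P, Metric.closedBall y (ρ / 2)) ⊆ approxAddOrderOf (Torus d) q ρ := by
    refine Set.iUnion₂_subset fun y hy x hx => ?_
    rw [mem_approx_add_orderOf_iff]
    exact ⟨y, hPq y hy, Metric.closedBall_subset_ball (by linarith) hx⟩
  have hdisj : (P : Set (Torus d)).PairwiseDisjoint fun y => Metric.closedBall y (ρ / 2) := by
    intro y hy z hz hne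
    refine Metric.closedBall_disjoint_closedBall ?_
    by_contra! hlt
    refine hne (eq_of_torsion_of_dist_lt hq (addOrderOf_dvd_iff_nsmul_eq_zero.1 (hPq y hy).dvd)
      (addOrderOf_dvd_iff_nsmul_eq_zero.1 (hPq z hz).dvd) (hlt.trans_lt ?_))
    rw [lt_div_iff₀ hq']
    linarith
  have h1 := measure_mono (μ := volume) hsub
  rw [measure_biUnion_finset hdisj fun _ _ => Metric.isClosed_closedBall.measurableSet,
    Finset.sum_congr rfl fun y _ => volume_closedBall y (r := ρ / 2) (by linarith) (by nlinarith),
    Finset.sum_const, nsmul_eq_mul, ← ENNReal.ofReal_natCast,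
    ← ENNReal.ofReal_mul (by positivity), ENNReal.ofReal_le_iff_le_toReal (measure_ne_top _ _)]
    at h1
  refine le_trans ?_ h1
  have h2 := le_ncard_addOrderOf_eq hd hq
  rw [Set.ncard_eq_toFinset_card _ (finite_addOrderOf_eq hq)] at h2
  rw [mul_pow, mul_div_cancel₀ _ two_ne_zero, mul_div_right_comm]
  gcongr

/-- The intersection is covered by `σ`-balls about the points of order `r` that lie within `2ρ` of a
point of order `q`, and close pairs have been counted. If `2ρ` is below the spacing `1/lcm`, a close
pair would have to coincide, which is impossible for distinct exact orders. -/
lemma volume_inter_approxAddOrderOf_le_of_le {q r : ℕ} (hq : 0 < q) (hr : 0 < r) (hqr : q ≠ r)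
    {ρ σ : ℝ} (hσ : 0 ≤ σ) (hσρ : σ ≤ ρ) :
    volume.real (approxAddOrderOf (Torus d) q ρ ∩ approxAddOrderOf (Torus d) r σ) ≤
      20 ^ d * ((q * ρ) ^ d * (r * σ) ^ d) := by
  classical
  have hρ : 0 ≤ ρ := hσ.trans hσρ
  set s : Finset (Torus d × Torus d) :=
    ((finite_addOrderOf_eq (d := d) hq).toFinset ×ˢ (finite_addOrderOf_eq hr).toFinset).filter
      fun p => dist p.1 p.2 ≤ 2 * ρ with hs
  have hsm : ∀ p, p ∈ s ↔ (addOrderOf p.1 = q ∧ addOrderOf p.2 = r) ∧ dist p.1 p.2 ≤ 2 * ρ := by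
    intro p
    simp [hs]
  have hsub : approxAddOrderOf (Torus d) q ρ ∩ approxAddOrderOf (Torus d) r σ ⊆
      ⋃ p ∈ s, Metric.closedBall p.2 σ := by
    rintro x ⟨hx, hx'⟩
    rw [mem_approx_add_orderOf_iff] at hx hx'
    obtain ⟨y, hy, hxy⟩ := hx
    obtain ⟨z, hz, hxz⟩ := hx'
    refine Set.mem_biUnion (x := (y, z)) ((hsm _).2 ⟨⟨hy, hz⟩, ?_⟩)
      (Metric.ball_subset_closedBall hxz)
    have := dist_triangle_left y z x
    rw [Metric.mem_ball] at hxy hxz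
    change dist y z ≤ _
    linarith
  have h1 : volume (approxAddOrderOf (Torus d) q ρ ∩ approxAddOrderOf (Torus d) r σ) ≤
      ENNReal.ofReal (s.card * (2 * σ) ^ d) := by
    refine (measure_mono hsub).trans ((measure_biUnion_finset_le _ _).trans ?_)
    refine (Finset.sum_le_sum fun p _ => volume_closedBall_le p.2 hσ).trans ?_
    rw [Finset.sum_const, nsmul_eq_mul, ENNReal.ofReal_mul (by positivity),
      ENNReal.ofReal_natCast]
  refine (ENNReal.toReal_le_of_le_ofReal (by positivity) h1).trans ?_
  have htor : ∀ p ∈ s, q • p.1 = 0 ∧ r • p.2 = 0 ∧ dist p.1 p.2 ≤ 2 * ρ := fun p hp =>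
    ⟨addOrderOf_dvd_iff_nsmul_eq_zero.1 ((hsm p).1 hp).1.1.dvd,
      addOrderOf_dvd_iff_nsmul_eq_zero.1 ((hsm p).1 hp).1.2.dvd, ((hsm p).1 hp).2⟩
  rcases le_or_gt 1 ((q.lcm r : ℕ) * (2 * ρ)) with h | h
  · have h2 := card_close_pairs_le hq hr s h htor
    calc (s.card : ℝ) * (2 * σ) ^ d ≤ (5 * (2 * ρ) * q * r) ^ d * (2 * σ) ^ d := by gcongr
      _ = _ := by
        rw [← mul_pow, ← mul_pow, ← mul_pow]
        congr 1
        ring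
  · have hL : 0 < q.lcm r := Nat.lcm_pos hq hr
    have hL' : (0 : ℝ) < q.lcm r := by exact_mod_cast hL
    have : s = ∅ := by
      refine Finset.eq_empty_of_forall_notMem fun p hp => hqr ?_
      obtain ⟨h1, h2, h3⟩ := htor p hp
      have : p.1 = p.2 := by
        refine eq_of_torsion_of_dist_lt hL (addOrderOf_dvd_iff_nsmul_eq_zero.1
            ((addOrderOf_dvd_of_nsmul_eq_zero h1).trans (Nat.dvd_lcm_left q r)))
          (addOrderOf_dvd_iff_nsmul_eq_zero.1
            ((addOrderOf_dvd_of_nsmul_eq_zero h2).trans (Nat.dvd_lcm_right q r))) ?_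
        rw [lt_div_iff₀ hL']
        nlinarith
      rw [← ((hsm p).1 hp).1.1, ← ((hsm p).1 hp).1.2, this]
    rw [this]
    simp only [Finset.card_empty, Nat.cast_zero, zero_mul]
    positivity

lemma volume_inter_approxAddOrderOf_le {q r : ℕ} (hq : 0 < q) (hr : 0 < r) (hqr : q ≠ r)
    {ρ σ : ℝ} (hρ : 0 ≤ ρ) (hσ : 0 ≤ σ) :
    volume.real (approxAddOrderOf (Torus d) q ρ ∩ approxAddOrderOf (Torus d) r σ) ≤
      20 ^ d * ((q * ρ) ^ d * (r * σ) ^ d) := by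
  rcases le_total σ ρ with h | h
  · exact volume_inter_approxAddOrderOf_le_of_le hq hr hqr hσ h
  · rw [Set.inter_comm, mul_comm ((q * ρ) ^ d)]
    exact volume_inter_approxAddOrderOf_le_of_le hr hq hqr.symm hρ h

lemma norm_coe_le_abs (x : ℝ) : ‖(x : UnitAddCircle)‖ ≤ |x| := by
  rw [UnitAddCircle.norm_eq]
  simpa using round_le x 0

/-- Dyadic points are dense. They form the union of the iterated kernels of doubling, and density of
that union is the ergodicity criterion used next. -/
lemma dense_two_power_torsion :
    Dense (⋃ n, (nsmulAddMonoidHom 2 : Torus d →+ Torus d)^[n] ⁻¹' 0) := by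
  have hit : ∀ (n : ℕ) (y : Torus d), (nsmulAddMonoidHom 2 : Torus d →+ Torus d)^[n] y =
      2 ^ n • y := by
    intro n
    induction n with
    | zero => simp
    | succ n ih =>
      intro y
      rw [Function.iterate_succ_apply', ih, pow_succ', mul_smul]
      rfl
  rw [Metric.dense_iff]
  intro y ε hε
  obtain ⟨n, hn⟩ := exists_pow_lt_of_lt_one hε (by norm_num : (1 / 2 : ℝ) < 1)
  choose t ht using fun i => QuotientAddGroup.mk_surjective (y i)
  refine ⟨fun i => ((round (2 ^ n * t i) / 2 ^ n : ℝ) : UnitAddCircle), ?_, ?_⟩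
  · rw [Metric.mem_ball, dist_pi_lt_iff hε]
    intro i
    rw [← ht i, dist_eq_norm]
    change ‖(((round (2 ^ n * t i) / 2 ^ n : ℝ) : UnitAddCircle) - ((t i : ℝ) : UnitAddCircle))‖ < ε
    rw [← AddCircle.coe_sub]
    refine (norm_coe_le_abs _).trans_lt (lt_of_le_of_lt ?_ hn)
    have h1 := abs_sub_round (2 ^ n * t i)
    have h2 : (round (2 ^ n * t i) / 2 ^ n : ℝ) - t i =
        -((2 ^ n * t i - round (2 ^ n * t i)) * (1 / 2) ^ n) := by
      rw [one_div, inv_pow]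
      field_simp
      ring
    rw [h2, abs_neg, abs_mul, abs_of_pos (a := ((1 : ℝ) / 2) ^ n) (by positivity)]
    have : (0 : ℝ) < (1 / 2) ^ n := by positivity
    nlinarith
  · rw [Set.mem_iUnion]
    refine ⟨n, ?_⟩
    rw [Set.mem_preimage, hit, Set.mem_zero]
    ext i
    simp only [Pi.smul_apply, Pi.zero_apply]
    rw [← AddCircle.coe_nsmul, AddCircle.coe_eq_zero_iff]
    refine ⟨round (2 ^ n * t i), ?_⟩
    simp
    field_simp

lemma ergodic_two_nsmul : Ergodic (fun x : Torus d => 2 • x) := by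
  have := AddMonoidHom.ergodic_of_dense_iUnion_preimage_zero (μ := (volume : Measure (Torus d)))
    (nsmulAddMonoidHom 2) dense_two_power_torsion (continuous_const_smul 2) ?_
  · exact this
  · intro y
    choose t ht using fun i => QuotientAddGroup.mk_surjective (y i)
    refine ⟨fun i => ((t i / 2 : ℝ) : UnitAddCircle), ?_⟩
    ext i
    rw [← ht i]
    change 2 • ((t i / 2 : ℝ) : UnitAddCircle) = ((t i : ℝ) : UnitAddCircle)
    rw [← AddCircle.coe_nsmul]
    congr 1
    simp
    ring

/-- A point within `ψ(q)/q` of a point of order `q` satisfies `‖q • x‖ < ψ(q)`. The constant is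
`1/(1 + K)` with `K = 16 * 20^d`: the overlap bound costs `20^d`, and each of the two lower volume
bounds costs a factor 4. -/
lemma le_volume_frequently_norm_nsmul_lt (hd : 2 ≤ d) {ψ : ℕ → ℝ} (h0 : ∀ q, 0 ≤ ψ q)
    (h1 : ∀ q, ψ q ≤ 1 / 2) (hsum : ¬ Summable fun q => ψ q ^ d) :
    1 / (1 + 16 * 20 ^ d) ≤ volume.real {x : Torus d | ∃ᶠ q : ℕ in atTop, ‖q • x‖ < ψ q} := by
  set A : ℕ → Set (Torus d) := fun q => approxAddOrderOf (Torus d) (q + 1) (ψ (q + 1) / (q + 1 : ℕ))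
    with hA
  have hcancel : ∀ q : ℕ, ((q + 1 : ℕ) : ℝ) * (ψ (q + 1) / (q + 1 : ℕ)) = ψ (q + 1) := fun q =>
    mul_div_cancel₀ _ (by positivity)
  have hlow : ∀ q, ψ (q + 1) ^ d / 4 ≤ volume.real (A q) := by
    intro q
    have := le_volume_approxAddOrderOf hd (q.succ_pos) (ρ := ψ (q + 1) / (q + 1 : ℕ))
      (div_nonneg (h0 _) (by positivity)) (by rw [mul_comm, hcancel]; exact h1 _)
    rwa [hcancel] at this
  have hsum' : ¬ Summable fun q => volume.real (A q) := by
    intro h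
    have h2 : Summable fun q => ψ (q + 1) ^ d / 4 :=
      h.of_nonneg_of_le (fun q => div_nonneg (pow_nonneg (h0 _) _) (by norm_num)) hlow
    refine hsum ((summable_nat_add_iff 1).1 ?_)
    refine (h2.mul_left 4).congr fun q => ?_
    ring
  have hmeas : ∀ q, MeasurableSet (A q) := fun q => Metric.isOpen_thickening.measurableSet
  refine (le_measureReal_frequently_of_quasi_indep hmeas (by positivity) ?_ hsum').trans
    (measureReal_mono ?_)
  · intro m n hmn
    refine (volume_inter_approxAddOrderOf_le m.succ_pos n.succ_pos (by omega)
      (div_nonneg (h0 _) (by positivity)) (div_nonneg (h0 _) (by positivity))).trans ?_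
    rw [hcancel, hcancel]
    have e := mul_le_mul (hlow m) (hlow n) (div_nonneg (pow_nonneg (h0 _) _) (by norm_num))
      measureReal_nonneg
    have : (0 : ℝ) < 20 ^ d := by positivity
    nlinarith
  · intro x hx
    have hx' : ∃ᶠ q in atTop, ‖(q + 1) • x‖ < ψ (q + 1) := by
      refine Frequently.mono hx fun q hq => ?_
      obtain ⟨y, hy, hxy⟩ := mem_approx_add_orderOf_iff.1 hq
      have h2 : (q + 1) • y = 0 := addOrderOf_dvd_iff_nsmul_eq_zero.1 hy.dvd
      have h3 : (q + 1) • x = (q + 1) • (x - y) := by rw [smul_sub, h2, sub_zero]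
      rw [h3]
      refine (norm_nsmul_le).trans_lt ?_
      rw [Metric.mem_ball, dist_eq_norm, lt_div_iff₀ (by positivity), mul_comm] at hxy
      exact hxy
    exact (tendsto_add_atTop_nat 1).frequently hx'

/-- Gallagher's theorem on simultaneous approximation in dimension at least two: the divergence
half of Khintchine's theorem without monotonicity. -/
theorem ae_frequently_norm_nsmul_lt (hd : 2 ≤ d) {ψ : ℕ → ℝ} (h0 : ∀ q, 0 ≤ ψ q)
    (h1 : ∀ q, ψ q ≤ 1 / 2) (hsum : ¬ Summable fun q => ψ q ^ d) :
    ∀ᵐ x : Torus d, ∃ᶠ q : ℕ in atTop, ‖q • x‖ < ψ q := by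
  -- Doubling `x` may double `‖q • x‖`, so a single `W k` need not be invariant, but doubling maps
  -- `W (2k+1)` into `W k` and hence the intersection into itself. Rescaling `ψ` preserves
  -- divergence, so all `W k` share one lower bound, which passes to the intersection.
  set W : ℕ → Set (Torus d) := fun k => {x | ∃ᶠ q : ℕ in atTop, ‖q • x‖ < ψ q / (k + 1)} with hW
  have hmeas : ∀ k, MeasurableSet (W k) := by
    intro k
    have : W k = limsup (fun q : ℕ => {x : Torus d | ‖q • x‖ < ψ q / (k + 1)}) atTop := by
      ext x
      simp [hW, mem_limsup_iff_frequently_mem]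
    rw [this]
    refine MeasurableSet.measurableSet_limsup fun q => ?_
    exact measurableSet_lt (by fun_prop) measurable_const
  have hanti : Antitone W := by
    intro k l hkl x hx
    refine Frequently.mono hx fun q hq => hq.trans_le ?_
    have := h0 q
    gcongr
  have hlow : ∀ k, 1 / (1 + 16 * 20 ^ d) ≤ volume.real (W k) := by
    intro k
    refine le_volume_frequently_norm_nsmul_lt hd (fun q => div_nonneg (h0 q) (by positivity))
      (fun q => (div_le_self (h0 q) (by simp)).trans (h1 q)) fun h => hsum ?_
    refine (h.mul_left ((k + 1 : ℝ) ^ d)).congr fun q => ?_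
    rw [div_pow]
    field_simp
  set V := ⋂ k, W k with hV
  have hVmeas : MeasurableSet V := MeasurableSet.iInter hmeas
  have hVlow : ENNReal.ofReal (1 / (1 + 16 * 20 ^ d)) ≤ volume V := by
    rw [hV, hanti.measure_iInter (fun M => (hmeas M).nullMeasurableSet) ⟨0, measure_ne_top _ _⟩]
    exact le_iInf fun k => (ENNReal.ofReal_le_iff_le_toReal (measure_ne_top _ _)).2 (hlow k)
  have hinv : V ⊆ (fun x : Torus d => 2 • x) ⁻¹' V := by
    intro x hx
    rw [Set.mem_preimage, hV, Set.mem_iInter]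
    intro k
    refine Frequently.mono (Set.mem_iInter.1 hx (2 * k + 1)) fun q hq => ?_
    rw [smul_comm]
    refine (norm_nsmul_le).trans_lt ?_
    have e : ψ q / (k + 1) = 2 * (ψ q / ((2 * k + 1 : ℕ) + 1)) := by
      push_cast
      field_simp
      ring
    rw [e]
    push_cast at hq ⊢
    linarith
  rcases ergodic_two_nsmul.ae_empty_or_univ_of_ae_le_preimage hVmeas.nullMeasurableSet
    (LE.le.eventuallyLE hinv) with h | h
  · rw [measure_congr h, measure_empty] at hVlow
    have : (0 : ℝ) < 1 / (1 + 16 * 20 ^ d) := by positivity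
    exact absurd hVlow (by simpa using this)
  · filter_upwards [eventuallyEq_univ.1 h] with x hx
    simpa [hW] using Set.mem_iInter.1 hx 0

end Torus

/-! ### Transfer between the unit cube and the torus. -/

namespace Torus

variable {d : ℕ}

/-- The projection of `ℝ^d` onto the torus. -/
def mk (α : Fin d → ℝ) : Torus d := fun i => (α i : UnitAddCircle)

lemma ae_mk_of_ae {p : Torus d → Prop} (h : ∀ᵐ x : Torus d, p x) :
    ∀ᵐ α : Fin d → ℝ ∂(volume.restrict (Set.Icc 0 1)), p (mk α) := by
  have h1 : volume.restrict (Set.Icc (0 : Fin d → ℝ) 1) =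
      Measure.pi fun _ : Fin d => (volume : Measure ℝ).restrict (Set.Ioc 0 (0 + 1)) := by
    rw [← Measure.restrict_pi_pi, ← volume_pi]
    refine Measure.restrict_congr_set ?_
    have := (Measure.univ_pi_Ioc_ae_eq_Icc (μ := fun _ : Fin d => (volume : Measure ℝ))
      (f := 0) (g := 1)).symm
    simpa [← volume_pi] using this
  have h2 : MeasurePreserving (mk (d := d)) (volume.restrict (Set.Icc 0 1)) volume := by
    rw [h1]
    exact measurePreserving_pi _ _ fun _ => UnitAddCircle.measurePreserving_mk 0
  exact h2.quasiMeasurePreserving.ae h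

/-- Multiplying each coordinate by a nonzero integer preserves Haar measure, so the set is no larger
than a ball of radius `ρ`. -/
lemma volume_norm_zsmul_lt_le {c : Fin d → ℤ} (hc : ∀ i, c i ≠ 0) {ρ : ℝ} (hρ : 0 ≤ ρ) :
    volume {x : Torus d | ‖fun i => c i • x i‖ < ρ} ≤ ENNReal.ofReal ((2 * ρ) ^ d) := by
  have hmp : MeasurePreserving (fun (x : Torus d) i => c i • x i) volume volume :=
    measurePreserving_pi _ _ fun i => Measure.measurePreserving_zsmul volume (hc i)
  calc _ ≤ volume ((fun (x : Torus d) i => c i • x i) ⁻¹' Metric.closedBall 0 ρ) := by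
        refine measure_mono fun x hx => ?_
        rw [Set.mem_preimage, mem_closedBall_zero_iff]
        exact le_of_lt hx
    _ = volume (Metric.closedBall (0 : Torus d) ρ) :=
        hmp.measure_preimage Metric.isClosed_closedBall.measurableSet.nullMeasurableSet
    _ ≤ _ := volume_closedBall_le 0 hρ

end Torus

/-! ### Nearest-integer distance and minimal gap as torus norms. -/

section Nid

variable {d : ℕ}

/-- Rounding each coordinate is optimal in all coordinates at once, so the infimum over integer
shifts is the sup of the circle norms. -/
lemma nid_eq_norm_mk (x : Fin d → ℝ) : nid x = ‖Torus.mk x‖ := by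
  apply le_antisymm
  · refine (ciInf_le ⟨0, ?_⟩ fun i => -round (x i)).trans ?_
    · rintro _ ⟨k, rfl⟩
      exact norm_nonneg _
    · rw [pi_norm_le_iff_of_nonneg (norm_nonneg _)]
      intro i
      refine le_trans (le_of_eq ?_) (norm_le_pi_norm (Torus.mk x) i)
      rw [Torus.mk, UnitAddCircle.norm_eq, Real.norm_eq_abs]
      simp [sub_eq_add_neg]
  · refine le_ciInf fun k => ?_
    rw [pi_norm_le_iff_of_nonneg (norm_nonneg _)]
    intro i
    have : Torus.mk x i = ((x i + k i : ℝ) : UnitAddCircle) := by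
      rw [AddCircle.coe_add, (AddCircle.coe_eq_zero_iff (1 : ℝ) (x := (k i : ℝ))).2 ⟨k i, by simp⟩,
        add_zero]
      rfl
    rw [this]
    exact (Torus.norm_coe_le_abs _).trans (norm_le_pi_norm (x + fun i => (k i : ℝ)) i)

lemma nid_fractSeq_sub (a : ℕ → Fin d → ℤ) (α : Fin d → ℝ) (m n : ℕ) :
    nid (fractSeq a α m - fractSeq a α n) = ‖fun i => (a m i - a n i) • Torus.mk α i‖ := by
  rw [nid_eq_norm_mk]
  congr 1
  ext i
  have hfr : ∀ x : ℝ, ((Int.fract x : ℝ) : UnitAddCircle) = x := by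
    intro x
    rw [Int.fract, AddCircle.coe_sub,
      (AddCircle.coe_eq_zero_iff (1 : ℝ) (x := (⌊x⌋ : ℝ))).2 ⟨⌊x⌋, by simp⟩, sub_zero]
  simp only [Torus.mk, Pi.sub_apply, fractSeq]
  rw [AddCircle.coe_sub, hfr, hfr, ← AddCircle.coe_sub, ← AddCircle.coe_zsmul]
  congr 1
  simp [sub_mul]

lemma nid_nonneg (x : Fin d → ℝ) : 0 ≤ nid x := by
  rw [nid_eq_norm_mk]
  exact norm_nonneg _

lemma minGap_le (x : ℕ → Fin d → ℝ) {m n N : ℕ} (hm : m < N) (hn : n < N) (hmn : m ≠ n) :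
    minGap x N ≤ nid (x n - x m) := by
  refine csInf_le ⟨0, ?_⟩ ⟨m, n, hm, hn, hmn, rfl⟩
  rintro _ ⟨m, n, -, -, -, rfl⟩
  exact nid_nonneg _

lemma le_minGap_fractSeq (a : ℕ → Fin d → ℤ) (α : Fin d → ℝ) {N : ℕ} (hN : 2 ≤ N) {δ : ℝ}
    (h : ∀ m n, m < n → n < N → δ ≤ ‖fun i => (a n i - a m i) • Torus.mk α i‖) :
    δ ≤ minGap (fractSeq a α) N := by
  refine le_csInf ⟨_, 0, 1, by omega, by omega, by omega, rfl⟩ ?_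
  rintro _ ⟨m, n, hm, hn, hmn, rfl⟩
  rw [nid_fractSeq_sub]
  rcases lt_or_gt_of_ne hmn with hlt | hlt
  · exact h m n hlt hn
  · refine (h n m hlt hm).trans (le_of_eq ?_)
    rw [← norm_neg]
    congr 1
    ext i
    simp only [Pi.neg_apply]
    rw [← neg_smul, neg_sub]

end Nid

/-! ### Size and growth of the sets of positive differences. -/

section Differences

lemma mem_firstTerms {β : Type*} [DecidableEq β] {a : ℕ → β} {N : ℕ} {b : β} :
    b ∈ firstTerms a N ↔ ∃ n < N, a n = b := by
  simp [firstTerms]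

lemma firstTerms_mono {β : Type*} [DecidableEq β] (a : ℕ → β) : Monotone (firstTerms a) :=
  fun _ _ h => Finset.image_subset_image (Finset.range_subset_range.2 h)

lemma card_firstTerms_sub_le {β : Type*} [DecidableEq β] [Sub β] (a : ℕ → β) (N : ℕ) :
    (firstTerms a N - firstTerms a N).card ≤ N ^ 2 := by
  have h : (firstTerms a N).card ≤ N := Finset.card_image_le.trans (Finset.card_range N).le
  rw [sq]
  exact Finset.card_sub_le.trans (Nat.mul_le_mul h h)

lemma posDiffVec_mono {d : ℕ} (a : ℕ → Fin d → ℤ) : Monotone (posDiffVec a) := fun _ _ h =>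
  Finset.filter_subset_filter _ (Finset.sub_subset_sub (firstTerms_mono a h) (firstTerms_mono a h))

lemma posDiff_mono (a : ℕ → ℤ) : Monotone (posDiff a) := fun _ _ h =>
  Finset.filter_subset_filter _ (Finset.sub_subset_sub (firstTerms_mono a h) (firstTerms_mono a h))

lemma card_posDiffVec_le {d : ℕ} (a : ℕ → Fin d → ℤ) (N : ℕ) : (posDiffVec a N).card ≤ N ^ 2 :=
  (Finset.card_filter_le _ _).trans (card_firstTerms_sub_le a N)

lemma card_posDiff_le (a : ℕ → ℤ) (N : ℕ) : (posDiff a N).card ≤ N ^ 2 :=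
  (Finset.card_filter_le _ _).trans (card_firstTerms_sub_le a N)

lemma sub_mem_posDiffVec {d : ℕ} {a : ℕ → Fin d → ℤ} (ha : ∀ i, StrictMono fun n => a n i)
    {m n N : ℕ} (hmn : m < n) (hn : n < N) : a n - a m ∈ posDiffVec a N := by
  refine Finset.mem_filter.2 ⟨Finset.sub_mem_sub (mem_firstTerms.2 ⟨n, hn, rfl⟩)
    (mem_firstTerms.2 ⟨m, hmn.trans hn, rfl⟩), fun i => ?_⟩
  exact sub_pos.2 (ha i hmn)

lemma le_card_posDiffVec {d : ℕ} [NeZero d] {a : ℕ → Fin d → ℤ}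
    (ha : ∀ i, StrictMono fun n => a n i) (N : ℕ) : N ≤ (posDiffVec a (N + 1)).card := by
  have h := Finset.card_le_card_of_injOn (s := Finset.range N) (t := posDiffVec a (N + 1))
    (fun n => a (n + 1) - a 0) (fun n hn => sub_mem_posDiffVec ha (by omega)
      (by have := Finset.mem_range.1 hn; omega)) ?_
  · simpa using h
  · intro m _ n _ h
    have : a (m + 1) 0 = a (n + 1) 0 := congrFun (sub_left_injective h) 0
    have := (ha 0).injective this
    omega

lemma mem_posDiff {a : ℕ → ℤ} {N : ℕ} {c : ℤ} :
    c ∈ posDiff a N ↔ (∃ n < N, ∃ m < N, a n - a m = c) ∧ 0 < c := by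
  simp [posDiff, Finset.mem_sub, mem_firstTerms]

/-- Subtract the smallest of the first `N + 1` terms from each of the others. -/
lemma le_card_posDiff {a : ℕ → ℤ} (ha : Function.Injective a) (N : ℕ) :
    N ≤ (posDiff a (N + 1)).card := by
  obtain ⟨k, hk, hmin⟩ := Finset.exists_min_image (Finset.range (N + 1)) a ⟨0, by simp⟩
  have h := Finset.card_le_card_of_injOn (s := (Finset.range (N + 1)).erase k)
    (t := posDiff a (N + 1)) (fun n => a n - a k) (fun n hn => ?_)
    fun m _ n _ h => ha (sub_left_injective h)
  · rwa [Finset.card_erase_of_mem hk, Finset.card_range, Nat.add_sub_cancel] at h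
  · have hn : n ∈ (Finset.range (N + 1)).erase k := hn
    obtain ⟨hnk, hnN⟩ := Finset.mem_erase.1 hn
    refine mem_posDiff.2 ⟨⟨n, Finset.mem_range.1 hnN, k, Finset.mem_range.1 hk, rfl⟩, ?_⟩
    exact sub_pos.2 (lt_of_le_of_ne (hmin n hnN) fun h => hnk (ha h.symm))

lemma card_posDiff_succ_le (a : ℕ → ℤ) (N : ℕ) :
    (posDiff a (N + 1)).card ≤ (posDiff a N).card + N := by
  have hsub : posDiff a (N + 1) ⊆ posDiff a N ∪ (Finset.range N).image fun n => |a N - a n| := by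
    intro c hc
    obtain ⟨⟨n, hn, m, hm, rfl⟩, hpos⟩ := mem_posDiff.1 hc
    rw [Finset.mem_union]
    rcases Nat.lt_succ_iff_lt_or_eq.1 hn with hn | rfl <;>
      rcases Nat.lt_succ_iff_lt_or_eq.1 hm with hm | rfl
    · exact Or.inl (mem_posDiff.2 ⟨⟨n, hn, m, hm, rfl⟩, hpos⟩)
    · exact Or.inr (Finset.mem_image.2 ⟨n, Finset.mem_range.2 hn, by
        rw [abs_sub_comm, abs_of_pos hpos]⟩)
    · exact Or.inr (Finset.mem_image.2 ⟨m, Finset.mem_range.2 hm, abs_of_pos hpos⟩)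
    · simp at hpos
  refine (Finset.card_le_card hsub).trans ((Finset.card_union_le _ _).trans ?_)
  gcongr
  exact Finset.card_image_le.trans (Finset.card_range N).le

/-- Take `n j` to be the first `N` with `C_N ≥ 4^j`. The last step adds at most `n j - 1 ≤ 4^j`
differences, so `C` is at most `2 * 4^j` there, half of the next threshold. The bounds on `n j` make
`log (n j)` comparable to `j`. -/
lemma exists_doubling_lengths {a : ℕ → ℤ} (ha : Function.Injective a) :
    ∃ n : ℕ → ℕ, Monotone n ∧ (∀ j, 2 ^ j ≤ n j) ∧ (∀ j, n j ≤ 4 ^ j + 1) ∧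
      (∀ j, 4 ^ j ≤ (posDiff a (n j)).card) ∧
      ∀ j, 2 * (posDiff a (n j)).card ≤ (posDiff a (n (j + 1))).card := by
  classical
  have hex : ∀ j : ℕ, ∃ N, 4 ^ j ≤ (posDiff a N).card := fun j => ⟨_, le_card_posDiff ha (4 ^ j)⟩
  set n : ℕ → ℕ := fun j => Nat.find (hex j) with hn
  have hspec : ∀ j, 4 ^ j ≤ (posDiff a (n j)).card := fun j => Nat.find_spec (hex j)
  have hle : ∀ j, n j ≤ 4 ^ j + 1 := fun j => Nat.find_min' (hex j) (le_card_posDiff ha (4 ^ j))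
  have hup : ∀ j, (posDiff a (n j)).card ≤ 2 * 4 ^ j := by
    intro j
    have hpos : 0 < 4 ^ j := by positivity
    rcases Nat.eq_zero_or_pos (n j) with h0 | h0
    · have := card_posDiff_le a (n j)
      rw [h0] at this ⊢
      omega
    · obtain ⟨m, hm⟩ := Nat.exists_eq_succ_of_ne_zero h0.ne'
      have h1 : (posDiff a m).card < 4 ^ j := by
        by_contra! h
        have : n j ≤ m := Nat.find_min' (hex j) h
        omega
      have h2 := card_posDiff_succ_le a m
      have h3 := hle j
      rw [hm] at h3 ⊢
      rw [Nat.succ_eq_add_one] at *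
      omega
  refine ⟨n, fun i j hij => ?_, fun j => ?_, hle, hspec, fun j => ?_⟩
  · exact Nat.find_min' (hex i) ((Nat.pow_le_pow_right (by norm_num) hij).trans (hspec j))
  · have h := (hspec j).trans (card_posDiff_le a (n j))
    rw [show 4 ^ j = (2 ^ j) ^ 2 by rw [← pow_mul, mul_comm, pow_mul]; norm_num] at h
    exact (Nat.pow_le_pow_iff_left two_ne_zero).1 h
  · have h1 := hup j
    have h2 := hspec (j + 1)
    rw [pow_succ] at h2
    omega

end Differences

/-! ### Bertrand series by Cauchy condensation. -/

section Series

lemma summable_condensed_inv_mul_log_rpow_iff {c s : ℝ} (hc : 0 < c) (hs : 0 < s) :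
    (Summable fun k : ℕ => (2 : ℝ) ^ k * (1 / (c * (2 ^ k : ℕ) * Real.log (c * (2 ^ k : ℕ)) ^ s))) ↔
      Summable fun j : ℕ => 1 / (c * j * Real.log (c * j) ^ s) := by
  have htend : Tendsto (fun j : ℕ => c * (j : ℝ)) atTop atTop :=
    tendsto_natCast_atTop_atTop.const_mul_atTop hc
  refine summable_condensed_iff_of_eventually_nonneg
    (f := fun j : ℕ => 1 / (c * j * Real.log (c * j) ^ s)) ?_ ?_
  · filter_upwards [htend.eventually_gt_atTop 1] with j hj
    have := Real.log_pos hj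
    simp only [Pi.zero_apply]
    positivity
  · filter_upwards [htend.eventually_gt_atTop 1] with j hj
    have := Real.log_pos hj
    have hle : c * (j : ℝ) ≤ c * ((j + 1 : ℕ) : ℝ) := by
      push_cast
      nlinarith
    have := Real.log_le_log (by linarith) hle
    gcongr

lemma log_mul_two_pow {c : ℝ} (hc : 0 < c) (k : ℕ) :
    Real.log (c * (2 ^ k : ℕ)) = Real.log c + k * Real.log 2 := by
  rw [Real.log_mul hc.ne' (by positivity)]
  push_cast
  rw [Real.log_pow]

lemma summable_inv_mul_log_rpow {c s : ℝ} (hc : 0 < c) (hs : 1 < s) :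
    Summable fun j : ℕ => 1 / (c * j * Real.log (c * j) ^ s) := by
  rw [← summable_condensed_inv_mul_log_rpow_iff hc (by linarith)]
  have hl2 : 0 < Real.log 2 := Real.log_pos (by norm_num)
  have hsum : Summable fun k : ℕ => 1 / (c * (Real.log 2 / 2) ^ s) * (1 / (k : ℝ) ^ s) :=
    (Real.summable_one_div_nat_rpow.2 hs).mul_left _
  refine Summable.of_norm_bounded_eventually_nat hsum ?_
  have htend : Tendsto (fun k : ℕ => (k : ℝ) * (Real.log 2 / 2)) atTop atTop :=
    tendsto_natCast_atTop_atTop.atTop_mul_const (by positivity)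
  -- `log c` may be negative; for large `k` half of `k log 2` outweighs it and the other half
  -- remains.
  filter_upwards [htend.eventually_ge_atTop (-Real.log c), eventually_gt_atTop 0] with k hk hk0
  have hk0' : (0 : ℝ) < k := by exact_mod_cast hk0
  have h1 : (k : ℝ) * (Real.log 2 / 2) ≤ Real.log (c * (2 ^ k : ℕ)) := by
    rw [log_mul_two_pow hc]
    linarith
  have h2 : (0 : ℝ) < (k : ℝ) * (Real.log 2 / 2) := by positivity
  have h3 : 0 < Real.log (c * (2 ^ k : ℕ)) := h2.trans_le h1
  rw [Real.norm_of_nonneg (by positivity)]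
  have h4 : (2 : ℝ) ^ k * (1 / (c * (2 ^ k : ℕ) * Real.log (c * (2 ^ k : ℕ)) ^ s)) =
      1 / (c * Real.log (c * (2 ^ k : ℕ)) ^ s) := by
    push_cast
    field_simp
  have h5 : 1 / (c * (Real.log 2 / 2) ^ s) * (1 / (k : ℝ) ^ s) =
      1 / (c * (k * (Real.log 2 / 2)) ^ s) := by
    rw [Real.mul_rpow hk0'.le (by positivity)]
    field_simp
  rw [h4, h5]
  gcongr

lemma not_summable_inv_mul_log {c : ℝ} (hc : 1 < c) :
    ¬ Summable fun j : ℕ => 1 / (c * j * Real.log (c * j)) := by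
  have hc0 : 0 < c := by linarith
  have hiff := summable_condensed_inv_mul_log_rpow_iff hc0 one_pos
  simp only [Real.rpow_one] at hiff
  rw [← hiff]
  intro h
  have hlc := Real.log_pos hc
  have hl2 : 0 < Real.log 2 := Real.log_pos (by norm_num)
  set K := Real.log c + Real.log 2 with hK
  refine Real.not_summable_one_div_natCast ((summable_nat_add_iff 1).1 ?_)
  refine (h.mul_left (c * K)).of_nonneg_of_le (fun k => by positivity) fun k => ?_
  have h4 : c * K * ((2 : ℝ) ^ k * (1 / (c * (2 ^ k : ℕ) * Real.log (c * (2 ^ k : ℕ))))) =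
      K / (Real.log c + k * Real.log 2) := by
    rw [← log_mul_two_pow hc0]
    push_cast
    field_simp
  rw [h4, div_le_div_iff₀ (by positivity) (by positivity)]
  push_cast
  have : (0 : ℝ) ≤ k := Nat.cast_nonneg k
  nlinarith

end Series

/-! ### The lower bound for all large `N`. -/

section Convergence

variable {d : ℕ}

/-- The convergence half: almost surely, for all large `j`, no vector of the finite set `U j` sends
the point into the ball of radius `ρ j`. -/
lemma ae_eventually_forall_le_norm_zsmul {U : ℕ → Finset (Fin d → ℤ)} {ρ : ℕ → ℝ}
    (hU : ∀ j, ∀ c ∈ U j, ∀ i, c i ≠ 0) (hρ : ∀ j, 0 ≤ ρ j)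
    (hsum : Summable fun j => ((U j).card : ℝ) * (2 * ρ j) ^ d) :
    ∀ᵐ x : Torus d, ∀ᶠ j in atTop, ∀ c ∈ U j, ρ j ≤ ‖fun i => c i • x i‖ := by
  have hmeas : ∀ j, volume (⋃ c ∈ U j, {x : Torus d | ‖fun i => c i • x i‖ < ρ j}) ≤
      ENNReal.ofReal (((U j).card : ℝ) * (2 * ρ j) ^ d) := by
    intro j
    refine (measure_biUnion_finset_le _ _).trans ?_
    refine (Finset.sum_le_sum fun c hc => Torus.volume_norm_zsmul_lt_le (hU j c hc) (hρ j)).trans ?_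
    rw [Finset.sum_const, nsmul_eq_mul, ENNReal.ofReal_mul (by positivity),
      ENNReal.ofReal_natCast]
  have hfin : ∑' j, volume (⋃ c ∈ U j, {x : Torus d | ‖fun i => c i • x i‖ < ρ j}) ≠ ⊤ :=
    ne_top_of_le_ne_top hsum.tsum_ofReal_ne_top (ENNReal.tsum_le_tsum hmeas)
  filter_upwards [ae_eventually_notMem hfin] with x hx
  filter_upwards [hx] with j hj c hc
  by_contra! hlt
  exact hj (Set.mem_biUnion hc hlt)

lemma ae_eventually_le_minGap (hd : 2 ≤ d) {a : ℕ → Fin d → ℤ}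
    (ha : ∀ i, StrictMono fun n => a n i) {ε : ℝ} (hε : 0 < ε) :
    ∀ᵐ α : Fin d → ℝ ∂(volume.restrict (Set.Icc 0 1)), ∀ᶠ N : ℕ in atTop,
      1 / (((posDiffVec a N).card : ℝ) ^ (1 / (d : ℝ)) * Real.log N ^ (1 / (d : ℝ))
          * Real.log (Real.log N) ^ (1 / (d : ℝ) + ε)) ≤ minGap (fractSeq a α) N := by
  have : NeZero d := ⟨by omega⟩
  have hd0 : (0 : ℝ) < d := by exact_mod_cast (by omega : 0 < d)
  -- The largest `M` with `C_M < 2^(j+1)`: its difference set contains those of all `N` in the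
  -- dyadic class `j`, so one union bound serves the whole class.
  have hex : ∀ j : ℕ, ∃ M, (posDiffVec a M).card < 2 ^ (j + 1) ∧
      ∀ N, (posDiffVec a N).card < 2 ^ (j + 1) → N ≤ M := by
    intro j
    have hb : ∀ N, (posDiffVec a N).card < 2 ^ (j + 1) → N ≤ 2 ^ (j + 1) := by
      intro N hN
      by_contra! h
      obtain ⟨m, rfl⟩ := Nat.exists_eq_succ_of_ne_zero (by omega : N ≠ 0)
      have := le_card_posDiffVec ha m
      rw [Nat.succ_eq_add_one] at *
      omega
    have h0 : (posDiffVec a 0).card < 2 ^ (j + 1) := by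
      have := card_posDiffVec_le a 0
      have : 0 < 2 ^ (j + 1) := by positivity
      omega
    refine ⟨Nat.findGreatest (fun N => (posDiffVec a N).card < 2 ^ (j + 1)) (2 ^ (j + 1)),
      Nat.findGreatest_spec (P := fun N => (posDiffVec a N).card < 2 ^ (j + 1))
        (Nat.zero_le _) h0, fun N hN => ?_⟩
    exact Nat.le_findGreatest (hb N hN) hN
  choose M hM hMmax using hex
  -- From `2^j ≤ C_N ≤ N^2` comes `c * j ≤ log N`, so `ρ j` dominates the target bound throughout
  -- the class. The absolute value in `ρ` only matters for small `j`, where it keeps `ρ`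
  -- nonnegative.
  set c : ℝ := Real.log 2 / 2 with hc
  have hl2 : 0 < Real.log 2 := Real.log_pos (by norm_num)
  have hc0 : 0 < c := by positivity
  set ρ : ℕ → ℝ := fun j => 1 / (((2 : ℝ) ^ j) ^ (1 / (d : ℝ)) * (c * j) ^ (1 / (d : ℝ)) *
    |Real.log (c * j)| ^ (1 / (d : ℝ) + ε)) with hρ
  have hρ0 : ∀ j, 0 ≤ ρ j := fun j => by positivity
  have hρd : ∀ j, ρ j ^ d = 1 / (2 ^ j * (c * j) * |Real.log (c * j)| ^ (1 + d * ε)) := by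
    intro j
    simp only [hρ]
    rw [div_pow, one_pow, mul_pow, mul_pow, one_div (d : ℝ),
      Real.rpow_inv_natCast_pow (by positivity) (by omega),
      Real.rpow_inv_natCast_pow (by positivity) (by omega),
      ← Real.rpow_mul_natCast (abs_nonneg _)]
    congr 3
    field_simp
  have hsum : Summable fun j => ((posDiffVec a (M j)).card : ℝ) * (2 * ρ j) ^ d := by
    have h1 := (summable_inv_mul_log_rpow hc0 (by nlinarith : 1 < 1 + d * ε)).mul_left (2 * 2 ^ d)
    refine Summable.of_norm_bounded_eventually_nat h1 ?_
    have htend : Tendsto (fun k : ℕ => c * (k : ℝ)) atTop atTop :=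
      tendsto_natCast_atTop_atTop.const_mul_atTop hc0
    filter_upwards [htend.eventually_gt_atTop 1] with j hj
    have hlog := Real.log_pos hj
    rw [Real.norm_of_nonneg (mul_nonneg (by positivity)
      (pow_nonneg (mul_nonneg zero_le_two (hρ0 j)) d)), mul_pow, hρd, abs_of_pos hlog]
    have hcard : ((posDiffVec a (M j)).card : ℝ) ≤ 2 ^ (j + 1) := by exact_mod_cast (hM j).le
    calc _ ≤ (2 : ℝ) ^ (j + 1) * (2 ^ d * (1 / (2 ^ j * (c * j) *
          Real.log (c * j) ^ (1 + d * ε)))) := by gcongr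
      _ = _ := by
        rw [pow_succ]
        field_simp
  have hU : ∀ j, ∀ v ∈ posDiffVec a (M j), ∀ i, v i ≠ 0 := fun j v hv i =>
    ((Finset.mem_filter.1 hv).2 i).ne'
  filter_upwards [Torus.ae_mk_of_ae (ae_eventually_forall_le_norm_zsmul hU hρ0 hsum)] with α hα
  have htendC : Tendsto (fun N => (posDiffVec a N).card) atTop atTop := by
    rw [← tendsto_add_atTop_iff_nat 1]
    exact tendsto_atTop_mono (le_card_posDiffVec ha) tendsto_id
  have htendlog : Tendsto (fun N => Nat.log 2 (posDiffVec a N).card) atTop atTop := by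
    refine tendsto_atTop.2 fun b => ?_
    filter_upwards [htendC.eventually_ge_atTop (2 ^ b)] with N hN
    exact Nat.le_log_of_pow_le (by norm_num) hN
  have htend : Tendsto (fun N => c * (Nat.log 2 (posDiffVec a N).card : ℝ)) atTop atTop :=
    (tendsto_natCast_atTop_atTop.comp htendlog).const_mul_atTop hc0
  filter_upwards [htendlog.eventually hα, htend.eventually_gt_atTop 1, eventually_ge_atTop 2,
    htendC.eventually_ge_atTop 1] with N hN hx hN2 hC1
  set C := (posDiffVec a N).card with hC
  set j := Nat.log 2 C with hj
  have hCj : 2 ^ j ≤ C := Nat.pow_log_le_self 2 (by omega)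
  have hCj' : C < 2 ^ (j + 1) := Nat.lt_pow_succ_log_self (by norm_num) C
  have hNM : N ≤ M j := hMmax j N hCj'
  have hxN : c * j ≤ Real.log N := by
    have h1 : (2 : ℝ) ^ j ≤ (N : ℝ) ^ 2 := by
      exact_mod_cast hCj.trans (card_posDiffVec_le a N)
    have h2 := Real.log_le_log (by positivity) h1
    rw [Real.log_pow, Real.log_pow] at h2
    push_cast at h2
    rw [hc]
    linarith
  have hlogpos : 0 < Real.log (c * j) := Real.log_pos hx
  have hloglog : Real.log (c * j) ≤ Real.log (Real.log N) :=
    Real.log_le_log (by linarith) hxN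
  have hCj2 : (2 : ℝ) ^ j ≤ C := by exact_mod_cast hCj
  have hle : 1 / ((C : ℝ) ^ (1 / (d : ℝ)) * Real.log N ^ (1 / (d : ℝ))
      * Real.log (Real.log N) ^ (1 / (d : ℝ) + ε)) ≤ ρ j := by
    have hcj : 0 < c * (j : ℝ) := by linarith
    simp only [hρ]
    rw [abs_of_pos hlogpos]
    gcongr
  refine hle.trans (le_minGap_fractSeq a α hN2 fun m n hmn hn => ?_)
  exact hN _ (posDiffVec_mono a hNM (sub_mem_posDiffVec ha hmn hn))

end Convergence

/-! ### The upper bound for infinitely many `N`. -/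

section Divergence

variable {d : ℕ}

/-- The divergence half along a nested family of finite sets whose sizes at least double. -/
lemma ae_frequently_exists_norm_nsmul_lt (hd : 2 ≤ d) {F : ℕ → Finset ℕ} (hF : Monotone F)
    (hcard : ∀ j, 2 * (F j).card ≤ (F (j + 1)).card) {δ : ℕ → ℝ} (h0 : ∀ j, 0 ≤ δ j)
    (h1 : ∀ j, δ j ≤ 1 / 2) (hsum : ¬ Summable fun j => ((F j).card : ℝ) * δ j ^ d) :
    ∀ᵐ x : Torus d, ∃ᶠ j in atTop, ∃ q ∈ F j, ‖q • x‖ < δ j := by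
  classical
  -- Each `q` gets the radius of the stage at which it first appears. A `q` that never appears gets
  -- 0, and `‖q • x‖ < 0` is impossible.
  set ψ : ℕ → ℝ := fun q => if h : ∃ j, q ∈ F j then δ (Nat.find h) else 0 with hψ
  have hψ0 : ∀ q, 0 ≤ ψ q := by
    intro q
    simp only [hψ]
    split_ifs
    exacts [h0 _, le_rfl]
  have hψ1 : ∀ q, ψ q ≤ 1 / 2 := by
    intro q
    simp only [hψ]
    split_ifs
    exacts [h1 _, by norm_num]
  have hψnew : ∀ j, ∀ q ∈ F (j + 1) \ F j, ψ q = δ (j + 1) := by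
    intro j q hq
    obtain ⟨hq1, hq2⟩ := Finset.mem_sdiff.1 hq
    have hex : ∃ j, q ∈ F j := ⟨_, hq1⟩
    simp only [hψ]
    rw [dif_pos hex]
    congr 1
    refine le_antisymm (Nat.find_min' hex hq1) ?_
    by_contra! hlt
    exact hq2 (hF (Nat.lt_succ_iff.1 hlt) (Nat.find_spec hex))
  have hψsum : ¬ Summable fun q => ψ q ^ d := by
    intro hs
    refine hsum ((summable_nat_add_iff 1).1 ?_)
    refine summable_of_sum_range_le (c := 2 * ∑' q, ψ q ^ d)
      (fun j => mul_nonneg (Nat.cast_nonneg _) (pow_nonneg (h0 _) _)) fun n => ?_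
    have hterm : ∀ j, ((F (j + 1)).card : ℝ) * δ (j + 1) ^ d ≤
        2 * ∑ q ∈ F (j + 1) \ F j, ψ q ^ d := by
      intro j
      rw [Finset.sum_congr rfl fun q hq => by rw [hψnew j q hq], Finset.sum_const, nsmul_eq_mul,
        ← mul_assoc]
      -- By doubling at least half of each stage is new, so the sum over first appearances loses
      -- only a factor 2.
      have h2 : (F (j + 1)).card ≤ 2 * (F (j + 1) \ F j).card := by
        have := Finset.card_sdiff_add_card_eq_card (hF (Nat.le_succ j))
        have := hcard j
        rw [Nat.succ_eq_add_one] at *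
        omega
      have h3 := pow_nonneg (h0 (j + 1)) d
      gcongr
      exact_mod_cast h2
    have hdisj : (Finset.range n : Set ℕ).PairwiseDisjoint fun j => F (j + 1) \ F j := by
      have key : ∀ i j, i < j → Disjoint (F (i + 1) \ F i) (F (j + 1) \ F j) := by
        intro i j hij
        refine Finset.disjoint_left.2 fun q hq hq' => ?_
        exact (Finset.mem_sdiff.1 hq').2 (hF hij (Finset.mem_sdiff.1 hq).1)
      intro i _ j _ hne
      rcases lt_or_gt_of_ne hne with h | h
      exacts [key i j h, (key j i h).symm]
    calc _ ≤ ∑ j ∈ Finset.range n, 2 * ∑ q ∈ F (j + 1) \ F j, ψ q ^ d :=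
          Finset.sum_le_sum fun j _ => hterm j
      _ = 2 * ∑ q ∈ (Finset.range n).biUnion fun j => F (j + 1) \ F j, ψ q ^ d := by
          rw [← Finset.mul_sum, Finset.sum_biUnion hdisj]
      _ ≤ _ := by
          gcongr
          exact hs.sum_le_tsum _ fun q _ => pow_nonneg (hψ0 q) d
  filter_upwards [Torus.ae_frequently_norm_nsmul_lt hd hψ0 hψ1 hψsum] with x hx
  rw [frequently_atTop]
  intro J
  -- A `q` exceeding every element of `F J` first appears after stage `J`.
  obtain ⟨q, hqJ, hq⟩ := frequently_atTop.1 hx ((F J).sup id + 1)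
  have hqF : q ∉ F J := by
    intro h
    have : q ≤ (F J).sup id := Finset.le_sup (f := id) h
    omega
  have hex : ∃ j, q ∈ F j := by
    by_contra h
    simp only [hψ] at hq
    rw [dif_neg h] at hq
    exact absurd hq (norm_nonneg _).not_gt
  simp only [hψ] at hq
  rw [dif_pos hex] at hq
  refine ⟨Nat.find hex, ?_, q, Nat.find_spec hex, hq⟩
  by_contra! hlt
  exact hqF (hF hlt.le (Nat.find_spec hex))

lemma ae_frequently_minGap_le (hd : 2 ≤ d) {a : ℕ → ℤ} (ha : Function.Injective a) :
    ∀ᵐ α : Fin d → ℝ ∂(volume.restrict (Set.Icc 0 1)), ∃ᶠ N : ℕ in atTop,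
      minGap (fractSeq (fun n _ => a n) α) N ≤
        1 / (((posDiff a N).card : ℝ) ^ (1 / (d : ℝ)) * Real.log N ^ (1 / (d : ℝ))
          * Real.log (Real.log N) ^ (1 / (d : ℝ))) := by
  have hd0 : (0 : ℝ) < d := by exact_mod_cast (by omega : 0 < d)
  obtain ⟨n, hmono, hlow, hup, hC, hdouble⟩ := exists_doubling_lengths ha
  -- The 5 gives `n ≥ 2^5`, so `log n ≥ e` and `log log n ≥ 1`; the `d` gives `C ≥ 4^d`, so `C^(1/d)
  -- ≥ 2` and the radius is at most `1/2`.
  set J := d + 5 with hJ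
  set F : ℕ → Finset ℕ := fun j => (posDiff a (n (j + J))).image Int.toNat with hF
  set g : ℕ → ℝ := fun N => 1 / (((posDiff a N).card : ℝ) ^ (1 / (d : ℝ))
    * Real.log N ^ (1 / (d : ℝ)) * Real.log (Real.log N) ^ (1 / (d : ℝ))) with hg
  have hFcard : ∀ j, (F j).card = (posDiff a (n (j + J))).card := by
    intro j
    refine Finset.card_image_of_injOn fun x hx y hy h => ?_
    have h1 := (mem_posDiff.1 hx).2
    have h2 := (mem_posDiff.1 hy).2
    have h : x.toNat = y.toNat := h
    omega
  have hFmono : Monotone F := fun i j hij =>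
    Finset.image_subset_image (posDiff_mono a (hmono (by omega)))
  have hlog1 : ∀ j, Real.exp 1 ≤ Real.log (n (j + J)) := by
    intro j
    have h1 : (2 : ℝ) ^ (5 : ℕ) ≤ n (j + J) := by
      have := (Nat.pow_le_pow_right (by norm_num : 0 < 2) (by omega : 5 ≤ j + J)).trans
        (hlow (j + J))
      exact_mod_cast this
    have h2 := Real.log_le_log (by norm_num) h1
    rw [Real.log_pow] at h2
    push_cast at h2
    linarith [Real.exp_one_lt_d9, Real.log_two_gt_d9]
  have hlog1' : ∀ j, 1 ≤ Real.log (n (j + J)) := fun j =>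
    (by linarith [Real.exp_one_gt_d9] : (1 : ℝ) ≤ Real.exp 1).trans (hlog1 j)
  have hloglog1 : ∀ j, 1 ≤ Real.log (Real.log (n (j + J))) := by
    intro j
    rw [Real.le_log_iff_exp_le (by linarith [hlog1' j])]
    exact hlog1 j
  have hg0 : ∀ j, 0 ≤ g (n (j + J)) := by
    intro j
    have h1 := hlog1' j
    have h2 := hloglog1 j
    simp only [hg]
    positivity
  have hg1 : ∀ j, g (n (j + J)) ≤ 1 / 2 := by
    intro j
    have h1 := Real.one_le_rpow (hlog1' j) (by positivity : 0 ≤ 1 / (d : ℝ))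
    have h2 := Real.one_le_rpow (hloglog1 j) (by positivity : 0 ≤ 1 / (d : ℝ))
    have h3 : (2 : ℝ) ≤ ((posDiff a (n (j + J))).card : ℝ) ^ (1 / (d : ℝ)) := by
      have h4 : 2 ^ d ≤ (posDiff a (n (j + J))).card :=
        ((Nat.pow_le_pow_left (by norm_num : 2 ≤ 4) d).trans
          (Nat.pow_le_pow_right (by norm_num) (by omega))).trans (hC (j + J))
      have h5 : (2 : ℝ) ^ d ≤ (posDiff a (n (j + J))).card := by exact_mod_cast h4
      rw [one_div, Real.le_rpow_inv_iff_of_pos (by norm_num) (by positivity) hd0,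
        Real.rpow_natCast]
      exact h5
    simp only [hg]
    gcongr
    nlinarith [mul_le_mul h3 h1 zero_le_one (by linarith)]
  have hgd : ∀ j, ((F j).card : ℝ) * g (n (j + J)) ^ d =
      1 / (Real.log (n (j + J)) * Real.log (Real.log (n (j + J)))) := by
    intro j
    have h1 := hlog1' j
    have h2 := hloglog1 j
    have h3 : 0 < (posDiff a (n (j + J))).card := lt_of_lt_of_le (by positivity) (hC (j + J))
    have h3' : (0 : ℝ) < (posDiff a (n (j + J))).card := by exact_mod_cast h3
    rw [hFcard]
    simp only [hg]
    rw [div_pow, one_pow, mul_pow, mul_pow, one_div (d : ℝ),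
      Real.rpow_inv_natCast_pow (by positivity) (by omega),
      Real.rpow_inv_natCast_pow (by positivity) (by omega),
      Real.rpow_inv_natCast_pow (by positivity) (by omega)]
    field_simp
  have hsum : ¬ Summable fun j => ((F j).card : ℝ) * g (n (j + J)) ^ d := by
    intro hs
    refine not_summable_inv_mul_log (by norm_num : (1 : ℝ) < 2) ((summable_nat_add_iff J).1 ?_)
    refine hs.of_nonneg_of_le (fun j => ?_) fun j => ?_
    · have : 0 ≤ Real.log (2 * ((j + J : ℕ) : ℝ)) := by
        rw [show (2 : ℝ) * ((j + J : ℕ) : ℝ) = ((2 * (j + J) : ℕ) : ℝ) by push_cast; ring]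
        exact Real.log_natCast_nonneg _
      positivity
    · rw [hgd]
      have h1 := hlog1' j
      have h2 := hloglog1 j
      -- From `n i ≤ 4^i + 1 ≤ 5^i ≤ e^(2i)` with `i = j + J`. The terms `1/(log n * log log n)`
      -- thus dominate `1/(2i log (2i))`, whose series diverges.
      have h3 : Real.log (n (j + J)) ≤ 2 * ((j + J : ℕ) : ℝ) := by
        have h4 : ((n (j + J) : ℕ) : ℝ) ≤ Real.exp 2 ^ (j + J) := by
          have h5 : n (j + J) ≤ 5 ^ (j + J) := by
            refine (hup _).trans ?_
            have := Nat.pow_lt_pow_left (by norm_num : 4 < 5) (by omega : j + J ≠ 0)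
            omega
          have h6 : (5 : ℝ) ≤ Real.exp 2 := by
            rw [show (2 : ℝ) = 1 + 1 by norm_num, Real.exp_add]
            nlinarith [Real.exp_one_gt_d9]
          calc ((n (j + J) : ℕ) : ℝ) ≤ 5 ^ (j + J) := by exact_mod_cast h5
            _ ≤ _ := by gcongr
        have hpos : (0 : ℝ) < n (j + J) := by
          have := hlow (j + J)
          have : 0 < n (j + J) := lt_of_lt_of_le (by positivity) this
          exact_mod_cast this
        have h7 := Real.log_le_log hpos h4
        rw [Real.log_pow, Real.log_exp] at h7
        linarith
      have h8 := Real.log_le_log (by linarith) h3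
      gcongr
  have hfreq := ae_frequently_exists_norm_nsmul_lt hd hFmono
    (fun j => by
      rw [hFcard, hFcard, show j + 1 + J = j + J + 1 by ring]
      exact hdouble _) hg0 hg1 hsum
  have htend : Tendsto (fun j => n (j + J)) atTop atTop := by
    refine tendsto_atTop_mono (fun j => ?_) tendsto_id
    have h1 := hlow (j + J)
    have h2 : j + J < 2 ^ (j + J) := Nat.lt_two_pow_self
    simp only [id]
    omega
  filter_upwards [Torus.ae_mk_of_ae hfreq] with α hα
  refine htend.frequently (hα.mono fun j => ?_)
  rintro ⟨q, hq, hlt⟩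
  obtain ⟨c, hc, rfl⟩ := Finset.mem_image.1 hq
  obtain ⟨⟨k, hk, m, hm, rfl⟩, hpos⟩ := mem_posDiff.1 hc
  have hne : m ≠ k := by
    rintro rfl
    simp at hpos
  refine (minGap_le _ hm hk hne).trans (le_trans (le_of_eq ?_) hlt.le)
  rw [nid_fractSeq_sub]
  congr 1
  ext i
  rw [Pi.smul_apply, ← natCast_zsmul, Int.toNat_of_nonneg hpos.le]

end Divergence

end MinimalGap

theorem theorem1 (d : ℕ) (hd : 2 ≤ d) :
    (∀ a : ℕ → Fin d → ℕ, (∀ i, StrictMono fun n => a n i) → ∀ ε : ℝ, 0 < ε →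
      ∀ᵐ α : Fin d → ℝ ∂(volume.restrict (Set.Icc 0 1)), ∀ᶠ N : ℕ in atTop,
        1 / (((MinimalGap.posDiffVec (fun n i => (a n i : ℤ)) N).card : ℝ) ^ (1 / (d : ℝ))
            * Real.log N ^ (1 / (d : ℝ))
            * Real.log (Real.log N) ^ (1 / (d : ℝ) + ε))
          ≤ MinimalGap.minGap (MinimalGap.fractSeq (fun n i => (a n i : ℤ)) α) N) ∧
    (∀ a : ℕ → ℤ, Function.Injective a →
      ∀ᵐ α : Fin d → ℝ ∂(volume.restrict (Set.Icc 0 1)), ∃ᶠ N : ℕ in atTop,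
        MinimalGap.minGap (MinimalGap.fractSeq (fun n _ => a n) α) N ≤
          1 / (((MinimalGap.posDiff a N).card : ℝ) ^ (1 / (d : ℝ))
            * Real.log N ^ (1 / (d : ℝ))
            * Real.log (Real.log N) ^ (1 / (d : ℝ)))) := by
  refine ⟨fun a ha ε hε => ?_, fun a ha => MinimalGap.ae_frequently_minGap_le hd ha⟩
  exact MinimalGap.ae_eventually_le_minGap hd
    (fun i m n hmn => Int.ofNat_lt.2 (ha i hmn)) hε
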